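/- A diffeological space is a set $X$ with a family of maps $U \to X$ (plots), $U$ open in some $\mathbb{R}^n$, that contains the constant maps, is closed under precomposition with smooth maps, and satisfies the sheaf condition for open covers; a map is smooth if it sends plots to plots. The $D$-topology on $X$ is the final topology with respect to the plots. A smooth manifold (finite-dimensional, Hausdorff, second countable, without boundary) carries the diffeology of all smooth maps in the usual sense, a product has as plots the maps whose components are plots, a subset has as plots the plots of the ambient space that take values in it, and the set $C^\infty(X,Y)$ of smooth maps has as plots the maps $p\colon U \to C^\infty(X,Y)$ for which $U \times X \to Y$, $(u,x) \mapsto p(u)(x)$, is smooth. Let $\mathbb{A}^n = \{(x_0,\dots,x_n) \in \mathbb{R}^{n+1} : \sum_i x_i = 1\}$ with the sub-diffeology. A diffeological space $Y$ is called fibrant if its smooth singular simplicial set $S^D(Y)$, with $S^D_n(Y) = C^\infty(\mathbb{A}^n, Y)$ and the simplicial structure induced by the standard affine maps between the $\mathbb{A}^n$, is a Kan complex. Let $X$ be a diffeological space that is compact in the $D$-topology, and let $N$ be a smooth manifold. Then $C^\infty(X,N)$ is fibrant. Moreover, for all $x_0 \in X$ and $n_0 \in N$, the pointed mapping space $C^\infty((X,x_0),(N,n_0))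 = \{f \in C^\infty(X,N) : f(x_0) = n_0\}$, with the sub-diffeology from $C^\infty(X,N)$, is fibrant. In particular, for every smooth manifold $N$, the free loop space $C^\infty(S^1,N)$ and, for all $s_0 \in S^1$ and $n_0 \in N$, the based loop space $C^\infty((S^1,s_0),(N,n_0))$ are fibrant. -/

import Mathlib

open scoped Manifold ContDiff

namespace Diffeology

universe u v

/-- The sub-diffeology: a map into a subtype is a plot iff it is a plot of the ambient space. -/
instance instSubtype {X : Type u} [DiffeologicalSpace X] (P : X → Prop) :
    DiffeologicalSpace (Subtype P) where
  plots _ := {p | IsPlot fun t => (p t : X)}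
  constant_plots x := DiffeologicalSpace.constant_plots (x : X)
  plot_reparam hp hf := DiffeologicalSpace.plot_reparam hp hf
  locality hp := DiffeologicalSpace.locality hp

/-- The product diffeology: a map into the product is a plot iff both components are plots. -/
instance instProd {X : Type u} {Y : Type v} [DiffeologicalSpace X] [DiffeologicalSpace Y] :
    DiffeologicalSpace (X × Y) where
  plots _ := {p | IsPlot (fun t => (p t).1) ∧ IsPlot (fun t => (p t).2)}
  constant_plots x := ⟨isPlot_const, isPlot_const⟩
  plot_reparam hp hf := ⟨isPlot_reparam hp.1 hf, isPlot_reparam hp.2 hf⟩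
  locality hp := by
    refine ⟨DiffeologicalSpace.locality fun x => ?_, DiffeologicalSpace.locality fun x => ?_⟩
    · obtain ⟨u, hu, hx, h⟩ := hp x
      exact ⟨u, hu, hx, fun hfu hf => (h hfu hf).1⟩
    · obtain ⟨u, hu, hx, h⟩ := hp x
      exact ⟨u, hu, hx, fun hfu hf => (h hfu hf).2⟩

/-- The set `C^∞(X, Y)` of smooth maps between diffeological spaces. -/
@[ext]
structure SmoothMap (X : Type u) (Y : Type v) [DiffeologicalSpace X] [DiffeologicalSpace Y] where
  toFun : X → Y
  smooth : DSmooth toFun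

namespace SmoothMap

variable {X : Type u} {Y : Type v} [DiffeologicalSpace X] [DiffeologicalSpace Y]

instance : FunLike (SmoothMap X Y) X Y where
  coe := toFun
  coe_injective f g h := by cases f; cases g; congr

/-- The functional diffeology on `C^∞(X, Y)`: a map `p : ℝⁿ → C^∞(X, Y)` is a plot iff
`ℝⁿ × X → Y`, `(t, x) ↦ p t x`, is smooth. -/
instance : DiffeologicalSpace (SmoothMap X Y) where
  plots n := {p | DSmooth fun z : EuclideanSpace ℝ (Fin n) × X => p z.1 z.2}
  constant_plots f := fun _ _ hq => f.smooth _ _ hq.2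
  plot_reparam {n m p f} hp hf := fun k q hq =>
    hp k (fun t => (f (q t).1, (q t).2)) ⟨(hf.comp hq.1.contDiff).isPlot, hq.2⟩
  locality {n p} hp := by
    intro k q hq
    have hq1 : ContDiff ℝ ∞ fun t => (q t).1 := hq.1.contDiff
    refine DiffeologicalSpace.locality fun t => ?_
    obtain ⟨u, hu, hxu, h⟩ := hp (q t).1
    refine ⟨_, hu.preimage hq1.continuous, hxu, fun {m f} hfu hf => ?_⟩
    exact h (f := fun s => (q (f s)).1) hfu (hq1.comp hf) m (fun s => (s, (q (f s)).2))
      ⟨isPlot_id, isPlot_reparam hq.2 hf⟩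

end SmoothMap

/-- The pointed mapping space `C^∞((X, x₀), (Y, y₀))`; as a subtype of `C^∞(X, Y)` it carries the
sub-diffeology. -/
abbrev PointedSmoothMap (X : Type u) (Y : Type v) [DiffeologicalSpace X] [DiffeologicalSpace Y]
    (x₀ : X) (y₀ : Y) : Type (max u v) :=
  {f : SmoothMap X Y // f x₀ = y₀}

/-- The standard diffeology on a manifold modelled on `ℝᵈ`: the plots are the maps that are
smooth in the usual sense. -/
abbrev standardDiffeology (d : ℕ) (N : Type u) [TopologicalSpace N]
    [ChartedSpace (EuclideanSpace ℝ (Fin d)) N] : DiffeologicalSpace N :=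
  .ofCorePlotsOn {
    isPlotOn := fun {n u} _ p => ContMDiffOn (𝓡 n) (𝓡 d) ∞ p u
    isPlotOn_congr := fun _ _ _ h => contMDiffOn_congr h
    isPlot := fun {n} p => ContMDiff (𝓡 n) (𝓡 d) ∞ p
    isPlotOn_univ := contMDiffOn_univ
    isPlot_const := fun _ => contMDiff_const
    isPlotOn_reparam := fun _ _ _ h hp hf => hp.comp hf.contMDiffOn h
    locality := fun _ _ h => fun x hxu => by
      obtain ⟨v, hv, hxv, hv'⟩ := h x hxu
      exact ((hv' x hxv).contMDiffAt (hv.mem_nhds hxv)).contMDiffWithinAt }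

/-- The affine simplex `𝔸ⁿ = {x ∈ ℝⁿ⁺¹ | ∑ xᵢ = 1}`, with the sub-diffeology from `ℝⁿ⁺¹`. -/
abbrev AffineSimplex (n : ℕ) : Type :=
  {x : EuclideanSpace ℝ (Fin (n + 1)) // ∑ i, x i = 1}

namespace AffineSimplex

/-- The map `𝔸ᵐ → 𝔸ⁿ` induced by a map of vertices: `(f_* x)ⱼ = ∑_{f i = j} xᵢ`. -/
noncomputable def map {m n : ℕ} (f : Fin (m + 1) → Fin (n + 1)) (x : AffineSimplex m) :
    AffineSimplex n :=
  ⟨WithLp.toLp 2 fun j => ∑ i with f i = j, x.1 i, by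
    simpa [Finset.sum_fiberwise] using x.2⟩

theorem dSmooth_map {m n : ℕ} (f : Fin (m + 1) → Fin (n + 1)) : DSmooth (map f) := by
  intro k p hp
  have hp' : ContDiff ℝ ∞ fun t => (p t : EuclideanSpace ℝ (Fin (m + 1))) :=
    IsPlot.contDiff (show IsPlot fun t => (p t : EuclideanSpace ℝ (Fin (m + 1))) from hp)
  have h : ContDiff ℝ ∞ fun t => (map f (p t) : EuclideanSpace ℝ (Fin (n + 1))) := by
    rw [contDiff_euclidean] at hp' ⊢
    intro j
    exact ContDiff.sum (s := {i | f i = j}) (f := fun i t => (p t).1 i) fun i _ => hp' i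
  exact h.isPlot

theorem map_id {n : ℕ} (x : AffineSimplex n) : map id x = x := by
  ext j
  simp [map, Finset.sum_filter]

theorem map_map {l m n : ℕ} (g : Fin (m + 1) → Fin (n + 1)) (f : Fin (l + 1) → Fin (m + 1))
    (x : AffineSimplex l) : map g (map f x) = map (g ∘ f) x := by
  ext j
  simp only [map, Finset.sum_filter, Function.comp_apply]
  simp_rw [← Finset.sum_filter]
  rw [Finset.sum_sigma']
  refine Finset.sum_bij' (fun a _ => a.2) (fun i _ => ⟨f i, i⟩) ?_ ?_ ?_ ?_ ?_ <;> aesop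

end AffineSimplex

open CategoryTheory in
/-- The smooth singular simplicial set `S^D(X)`, with `S^D_n(X) = C^∞(𝔸ⁿ, X)` and simplicial
structure maps given by precomposition. -/
noncomputable def smoothSingular (X : Type u) [DiffeologicalSpace X] : SSet.{u} where
  obj Δ := SmoothMap (AffineSimplex Δ.unop.len) X
  map φ := ↾fun s =>
    { toFun := fun x => s (AffineSimplex.map (SimplexCategory.Hom.toOrderHom φ.unop) x)
      smooth := s.smooth.comp (AffineSimplex.dSmooth_map _) }
  map_id Δ := by
    ext s x
    exact congrArg s (AffineSimplex.map_id x)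
  map_comp φ ψ := by
    ext s x
    exact congrArg s (AffineSimplex.map_map (SimplexCategory.Hom.toOrderHom φ.unop)
      (SimplexCategory.Hom.toOrderHom ψ.unop) x).symm

open SSet.modelCategoryQuillen in
/-- A diffeological space `X` is fibrant if `S^D(X)` is a Kan complex. -/
def Fibrant (X : Type u) [DiffeologicalSpace X] : Prop :=
  SSet.KanComplex (smoothSingular X)

end Diffeology

/-! By adjunction, a horn in the smooth singular set of C^∞(X, N) is a compatible family of smooth
maps {u_j = 0} × X → N, j ≠ i, over faces of 𝔸ⁿ⁺¹ ⊆ ℝⁿ⁺². It is filled by extending the family to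
ℝⁿ⁺² × X, one hyperplane at a time.

Let w be correct on the union L of the earlier hyperplanes, let g be prescribed on H = {u_k = 0},
and let π be the projection onto H that adds u_k to u_i; it preserves L. For N = ℝᵈ the map w(u) -
w(πu) + g(πu) equals w on L and g on H. On a manifold this becomes `move (w u, w (π u), g (π u),
1)`, where `move` transports its first argument along the displacement from the second to the third
(`exists_translation`, built from charts). It equals g on H only where w and g are close, so it is
interpolated with g ∘ π by a cutoff (`SmoothTranslation.exists_merge`). Closeness uniform in X is an
open condition on u because X is compact (`isOpen_setOf_forall_mem`). The interpolation is smooth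
only over a neighbourhood of L ∪ H, but L ∪ H is a closed cone, so all of ℝⁿ⁺² can be mapped
smoothly into this neighbourhood fixing L ∪ H (`exists_contDiff_mapsTo_of_cone`).

Since `move (n₀, n₀, n₀, t) = n₀`, every step keeps a point of X at n₀ if all data do. This yields
the pointed case. -/

namespace Diffeology

open Set Filter Topology

universe u v

/-! ### Translations on a manifold -/

section ManifoldTranslation

variable {d : ℕ} {N : Type u} [TopologicalSpace N] [ChartedSpace (EuclideanSpace ℝ (Fin d)) N]

/-- A chart around any point has, near that point, a smooth left inverse defined on all of `ℝᵈ`. -/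
theorem exists_chart_smooth_leftInverse [IsManifold (𝓡 d) ∞ N] (c : N) :
    ∃ (U : Set N) (φ : N → EuclideanSpace ℝ (Fin d)) (ψ : EuclideanSpace ℝ (Fin d) → N),
      IsOpen U ∧ c ∈ U ∧ ContMDiffOn (𝓡 d) (𝓡 d) ∞ φ U ∧ ContMDiff (𝓡 d) (𝓡 d) ∞ ψ ∧
      ∀ x ∈ U, ψ (φ x) = x := by
  set e := chartAt (EuclideanSpace ℝ (Fin d)) c with he
  have hc : c ∈ e.source := mem_chart_source _ c
  obtain ⟨R, hR, hball⟩ := Metric.isOpen_iff.1 e.open_target (e c) (e.map_source hc)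
  let b : ContDiffBump (e c) := ⟨R / 2, R, by positivity, by linarith⟩
  -- Damping the displacement from `e c` by the bump maps all of ℝᵈ into the `R`-ball inside the
  -- chart target, and is the identity on the `R / 2`-ball.
  let g : EuclideanSpace ℝ (Fin d) → EuclideanSpace ℝ (Fin d) := fun v => e c + b v • (v - e c)
  have hg : ContDiff ℝ ∞ g :=
    contDiff_const.add (b.contDiff.smul (contDiff_id.sub contDiff_const))
  have hg_mem : ∀ v, g v ∈ e.target := by
    intro v
    apply hball
    by_cases hv : v ∈ Metric.ball (e c) R
    · simp only [Metric.mem_ball, dist_eq_norm, g, add_sub_cancel_left, norm_smul] at hv ⊢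
      refine lt_of_le_of_lt ?_ hv
      rw [Real.norm_of_nonneg b.nonneg]
      exact mul_le_of_le_one_left (norm_nonneg _) b.le_one
    · have : b v = 0 := b.zero_of_le_dist (by simpa [b] using hv)
      simp [g, this, hR]
  refine ⟨e.source ∩ e ⁻¹' Metric.ball (e c) (R / 2), e, e.symm ∘ g,
    e.isOpen_inter_preimage Metric.isOpen_ball, ⟨hc, Metric.mem_ball_self (by positivity)⟩,
    (contMDiffOn_chart (I := 𝓡 d) (n := ∞)).mono inter_subset_left, ?_, ?_⟩
  · exact (contMDiffOn_chart_symm (I := 𝓡 d) (n := ∞) (x := c)).comp_contMDiff hg.contMDiff hg_mem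
  · rintro x ⟨hx, hxb⟩
    have : b (e x) = 1 := b.one_of_mem_closedBall (Metric.ball_subset_closedBall hxb)
    simp [g, this, e.left_inv hx]

/-- Moving points in a chart: a smooth map `S` on `N × N × N × ℝ` which translates `x` by `t` times
the vector from `y` to `z`, cut off by the bump function `χ`. -/
theorem exists_chart_translation {U : Set N} {φ : N → EuclideanSpace ℝ (Fin d)}
    {ψ : EuclideanSpace ℝ (Fin d) → N} {χ : N → ℝ} (hU : IsOpen U)
    (hφ : ContMDiffOn (𝓡 d) (𝓡 d) ∞ φ U) (hψ : ContMDiff (𝓡 d) (𝓡 d) ∞ ψ)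
    (hψφ : ∀ x ∈ U, ψ (φ x) = x) (hχ : ContMDiff (𝓡 d) 𝓘(ℝ, ℝ) ∞ χ) (hχU : tsupport χ ⊆ U) :
    ∃ S : N × N × N × ℝ → N,
      ContMDiff ((𝓡 d).prod ((𝓡 d).prod ((𝓡 d).prod 𝓘(ℝ, ℝ)))) (𝓡 d) ∞ S ∧
      (∀ x y z, S (x, y, z, 0) = x) ∧ (∀ x y t, S (x, y, y, t) = x) ∧
      (∀ x y z t, χ z = 0 → S (x, y, z, t) = x) ∧
      ∀ y z, χ y = 1 → χ z = 1 → S (y, y, z, 1) = z := by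
  classical
  -- The two cutoffs extend the chart displacement smoothly by zero to points where `φ` carries no
  -- information. The factor `χ p.1` in `T` plays the same role for the moved point.
  let V : N × N → EuclideanSpace ℝ (Fin d) := fun p => (χ p.1 * χ p.2) • (φ p.2 - φ p.1)
  have hV : ContMDiff ((𝓡 d).prod (𝓡 d)) (𝓡 d) ∞ V := by
    rintro ⟨y, z⟩
    by_cases hy : y ∈ tsupport χ
    · by_cases hz : z ∈ tsupport χ
      · have hφy := (hφ.contMDiffAt (hU.mem_nhds (hχU hy))).comp (y, z)
          (contMDiffAt_fst (I := 𝓡 d) (J := 𝓡 d))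
        have hφz := (hφ.contMDiffAt (hU.mem_nhds (hχU hz))).comp (y, z)
          (contMDiffAt_snd (I := 𝓡 d) (J := 𝓡 d))
        have h1 : ContMDiff ((𝓡 d).prod (𝓡 d)) 𝓘(ℝ, ℝ) ∞ fun p : N × N => χ p.1 * χ p.2 :=
          (hχ.comp contMDiff_fst).mul (hχ.comp contMDiff_snd)
        exact (h1.contMDiffAt (x := (y, z))).smul (hφz.sub hφy)
      · have : V =ᶠ[𝓝 (y, z)] fun _ => 0 := by
          have h := (notMem_tsupport_iff_eventuallyEq.1 hz)
          filter_upwards [(continuous_snd.tendsto (y, z)).eventually h] with p hp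
          simp only [Pi.zero_apply] at hp
          simp [V, hp]
        exact contMDiffAt_const.congr_of_eventuallyEq this
    · have : V =ᶠ[𝓝 (y, z)] fun _ => 0 := by
        have h := (notMem_tsupport_iff_eventuallyEq.1 hy)
        filter_upwards [(continuous_fst.tendsto (y, z)).eventually h] with p hp
        simp only [Pi.zero_apply] at hp
        simp [V, hp]
      exact contMDiffAt_const.congr_of_eventuallyEq this
  let T : N × EuclideanSpace ℝ (Fin d) → N :=
    fun p => if p.1 ∈ U then ψ (φ p.1 + χ p.1 • p.2) else p.1
  have hT0 : ∀ x, T (x, 0) = x := by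
    intro x
    by_cases hx : x ∈ U <;> simp [T, hx, hψφ]
  have hT : ContMDiff ((𝓡 d).prod (𝓡 d)) (𝓡 d) ∞ T := by
    rintro ⟨x, v⟩
    by_cases hx : x ∈ U
    · have hφx := (hφ.contMDiffAt (hU.mem_nhds hx)).comp (x, v)
        (contMDiffAt_fst (I := 𝓡 d) (J := 𝓡 d))
      have h1 : ContMDiff ((𝓡 d).prod (𝓡 d)) (𝓡 d) ∞
          fun p : N × EuclideanSpace ℝ (Fin d) => χ p.1 • p.2 :=
        (hχ.comp contMDiff_fst).smul contMDiff_snd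
      have h2 := (hψ.contMDiffAt).comp (x, v) (hφx.add (h1.contMDiffAt (x := (x, v))))
      refine h2.congr_of_eventuallyEq ?_
      filter_upwards [(continuous_fst.tendsto (x, v)).eventually (hU.mem_nhds hx)] with p hp
      exact if_pos hp
    · have hx' : x ∉ tsupport χ := fun h => hx (hχU h)
      refine (contMDiffAt_fst (I := 𝓡 d) (J := 𝓡 d)).congr_of_eventuallyEq ?_
      have h := (notMem_tsupport_iff_eventuallyEq.1 hx')
      filter_upwards [(continuous_fst.tendsto (x, v)).eventually h] with p hp
      simp only [Pi.zero_apply] at hp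
      by_cases hp' : p.1 ∈ U <;> simp [T, hp', hp, hψφ]
  refine ⟨fun q => T (q.1, q.2.2.2 • V (q.2.1, q.2.2.1)), ?_, ?_, ?_, ?_, ?_⟩
  · have h2 : ContMDiff ((𝓡 d).prod ((𝓡 d).prod ((𝓡 d).prod 𝓘(ℝ, ℝ)))) (𝓡 d) ∞
        fun q : N × N × N × ℝ => q.2.1 := contMDiff_fst.comp contMDiff_snd
    have h3 : ContMDiff ((𝓡 d).prod ((𝓡 d).prod ((𝓡 d).prod 𝓘(ℝ, ℝ)))) (𝓡 d) ∞
        fun q : N × N × N × ℝ => q.2.2.1 :=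
      contMDiff_fst.comp (contMDiff_snd.comp contMDiff_snd)
    have h4 : ContMDiff ((𝓡 d).prod ((𝓡 d).prod ((𝓡 d).prod 𝓘(ℝ, ℝ)))) 𝓘(ℝ, ℝ) ∞
        fun q : N × N × N × ℝ => q.2.2.2 :=
      contMDiff_snd.comp (contMDiff_snd.comp contMDiff_snd)
    exact hT.comp (contMDiff_fst.prodMk (h4.smul (hV.comp (h2.prodMk h3))))
  · intro x y z
    simp [hT0]
  · intro x y t
    simp [V, hT0]
  · intro x y z t hz
    simp [V, hz, hT0]
  · intro y z hy hz
    have hyU : y ∈ U := hχU (subset_tsupport _ (by simp [hy]))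
    have hzU : z ∈ U := hχU (subset_tsupport _ (by simp [hz]))
    simp [T, V, hyU, hy, hz, hψφ z hzU]

/-- A countable, locally finite family of chart translations which covers the manifold. -/
theorem exists_seq_chart_translation [IsManifold (𝓡 d) ∞ N] [T2Space N]
    [SecondCountableTopology N] :
    ∃ S : ℕ → N × N × N × ℝ → N,
      (∀ n, ContMDiff ((𝓡 d).prod ((𝓡 d).prod ((𝓡 d).prod 𝓘(ℝ, ℝ)))) (𝓡 d) ∞ (S n)) ∧
      (∀ n x y z, S n (x, y, z, 0) = x) ∧ (∀ n x y t, S n (x, y, y, t) = x) ∧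
      (∀ z₀, ∃ A, ∀ᶠ z in 𝓝 z₀, ∀ n ≥ A, ∀ x y t, S n (x, y, z, t) = x) ∧
      ∀ p, ∃ n, ∃ W ∈ 𝓝 p, ∀ y ∈ W, ∀ z ∈ W, S n (y, y, z, 1) = z := by
  have : LocallyCompactSpace N := ChartedSpace.locallyCompactSpace (EuclideanSpace ℝ (Fin d)) N
  choose U φ ψ hUo hcU hφ hψ hψφ using
    exists_chart_smooth_leftInverse (d := d) (N := N)
  obtain ⟨ι, f, hf⟩ := SmoothBumpCovering.exists_isSubordinate (𝓡 d) (s := (univ : Set N))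
    isClosed_univ (U := U) fun x _ => (hUo x).mem_nhds (hcU x)
  have hfin := f.locallyFinite
  have hcount : (univ : Set ι).Countable := by
    refine hfin.countable_univ fun i => ⟨f.c i, ?_⟩
    simp [Function.mem_support]
  have : Countable ι := countable_univ_iff.1 hcount
  have := Encodable.ofCountable ι
  choose S hS h0 hyy hz h1 using fun i => exists_chart_translation (hUo (f.c i)) (hφ (f.c i))
    (hψ (f.c i)) (hψφ (f.c i)) (f i).contMDiff (hf i)
  have hSn : ∀ n, (Encodable.decode₂ ι n).elim Prod.fst S = Prod.fst ∨
      ∃ i, Encodable.encode i = n ∧ (Encodable.decode₂ ι n).elim Prod.fst S = S i := by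
    intro n
    cases hn : Encodable.decode₂ ι n with
    | none => exact .inl rfl
    | some i => exact .inr ⟨i, Encodable.mem_decode₂.1 hn, rfl⟩
  refine ⟨fun n => (Encodable.decode₂ ι n).elim Prod.fst S, fun n => ?_, fun n x y z => ?_,
    fun n x y t => ?_, fun z₀ => ?_, fun p => ?_⟩
  · rcases hSn n with h | ⟨i, -, h⟩ <;> simp only [h]
    exacts [contMDiff_fst, hS i]
  · rcases hSn n with h | ⟨i, -, h⟩ <;> simp only [h]
    exact h0 i x y z
  · rcases hSn n with h | ⟨i, -, h⟩ <;> simp only [h]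
    exact hyy i x y t
  · obtain ⟨Z, hZ, hZfin⟩ := hfin z₀
    obtain ⟨A, hA⟩ := (hZfin.image (Encodable.encode (α := ι))).bddAbove
    refine ⟨A + 1, ?_⟩
    filter_upwards [hZ] with z hzZ n hn x y t
    rcases hSn n with h | ⟨i, hi, h⟩ <;> simp only [h]
    refine hz i x y z t (by_contra fun hne => ?_)
    have := hA ⟨i, ⟨z, hne, hzZ⟩, hi⟩
    omega
  · refine ⟨Encodable.encode (f.ind p (mem_univ p)), _, f.eventuallyEq_one p (mem_univ p), ?_⟩
    intro y hy z hz
    simp only [Encodable.encodek₂, Option.elim_some]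
    exact h1 _ y z hy hz

/-- A smooth manifold carries a globally defined smooth operation `M` such that `M (x, y, z, t)`
moves `x` by `t` times the displacement from `y` to `z`, as long as `y` and `z` are close. -/
theorem exists_translation (d : ℕ) (N : Type u) [TopologicalSpace N]
    [ChartedSpace (EuclideanSpace ℝ (Fin d)) N] [IsManifold (𝓡 d) ∞ N] [T2Space N]
    [SecondCountableTopology N] :
    ∃ (M : N × N × N × ℝ → N) (D : Set (N × N)),
      ContMDiff ((𝓡 d).prod ((𝓡 d).prod ((𝓡 d).prod 𝓘(ℝ, ℝ)))) (𝓡 d) ∞ M ∧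
      IsOpen D ∧ (∀ y, (y, y) ∈ D) ∧
      (∀ x y z, M (x, y, z, 0) = x) ∧ (∀ x y t, M (x, y, y, t) = x) ∧
      ∀ y z, (y, z) ∈ D → M (y, y, z, 1) = z := by
  obtain ⟨S, hS, h0, hyy, hfin, h1⟩ := exists_seq_chart_translation (d := d) (N := N)
  -- The second component records where `y` has been carried so far, so each step uses the
  -- displacement that still remains to `z`.
  let it : ℕ → N × N × N × ℝ → N × N := fun n => Nat.rec (fun q => (q.1, q.2.1))
    (fun n r q => (S n ((r q).1, (r q).2, q.2.2), S n ((r q).2, (r q).2, q.2.2))) n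
  have it_succ : ∀ n q, it (n + 1) q = (S n ((it n q).1, (it n q).2, q.2.2),
    S n ((it n q).2, (it n q).2, q.2.2)) := fun _ _ => rfl
  have hit : ∀ n, ContMDiff ((𝓡 d).prod ((𝓡 d).prod ((𝓡 d).prod 𝓘(ℝ, ℝ))))
      ((𝓡 d).prod (𝓡 d)) ∞ (it n) := by
    intro n
    induction n with
    | zero => exact contMDiff_fst.prodMk (contMDiff_fst.comp contMDiff_snd)
    | succ n ih =>
      have h2 : ContMDiff ((𝓡 d).prod ((𝓡 d).prod ((𝓡 d).prod 𝓘(ℝ, ℝ))))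
          ((𝓡 d).prod 𝓘(ℝ, ℝ)) ∞ fun q : N × N × N × ℝ => q.2.2 :=
        contMDiff_snd.comp contMDiff_snd
      exact ((hS n).comp ((contMDiff_fst.comp ih).prodMk
        ((contMDiff_snd.comp ih).prodMk h2))).prodMk ((hS n).comp
        ((contMDiff_snd.comp ih).prodMk ((contMDiff_snd.comp ih).prodMk h2)))
  have it0 : ∀ n x y z, it n (x, y, z, 0) = (x, y) := by
    intro n x y z
    induction n with
    | zero => rfl
    | succ n ih => simp [it_succ, ih, h0]
  have ityy : ∀ n x y t, it n (x, y, y, t) = (x, y) := by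
    intro n x y t
    induction n with
    | zero => rfl
    | succ n ih => simp [it_succ, ih, hyy]
  have itdiag : ∀ n y z t, (it n (y, y, z, t)).1 = (it n (y, y, z, t)).2 := by
    intro n y z t
    induction n with
    | zero => rfl
    | succ n ih => simp [it_succ, ih]
  choose A hA using hfin
  have hstable : ∀ z₀, ∀ᶠ z in 𝓝 z₀, ∀ n ≥ A z₀, ∀ x y t,
      it n (x, y, z, t) = it (A z₀) (x, y, z, t) := by
    intro z₀
    filter_upwards [hA z₀] with z hz n hn x y t
    induction n, hn using Nat.le_induction with
    | base => rfl
    | succ n hn ih => rw [it_succ, hz n hn, hz n hn, ← ih]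
  -- `A` need not be locally constant, but near each `z₀` the iterates are stationary from `A z₀`
  -- on, so `M` agrees locally with one smooth iterate.
  let M : N × N × N × ℝ → N := fun q => (it (A q.2.2.1) q).1
  have hM : ∀ z₀, ∀ᶠ z in 𝓝 z₀, ∀ n ≥ A z₀, ∀ x y t, M (x, y, z, t) = (it n (x, y, z, t)).1 := by
    intro z₀
    filter_upwards [hstable z₀] with z hz n hn x y t
    have h := (hstable z).self_of_nhds
    rcases le_total n (A z) with hle | hle
    · simp only [M]
      rw [hz n hn, hz (A z) (hn.trans hle)]
    · simp only [M]
      rw [h n hle]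
  refine ⟨M, interior {p | M (p.1, p.1, p.2, 1) = p.2}, ?_, isOpen_interior, ?_, ?_, ?_, ?_⟩
  · rintro ⟨x, y, z, t⟩
    refine (contMDiff_fst.comp (hit (A z))).contMDiffAt.congr_of_eventuallyEq ?_
    have hc : Tendsto (fun q : N × N × N × ℝ => q.2.2.1) (𝓝 (x, y, z, t)) (𝓝 z) :=
      (continuous_fst.comp (continuous_snd.comp continuous_snd)).tendsto (x, y, z, t)
    filter_upwards [hc.eventually (hM z)] with q hq
    exact hq _ le_rfl _ _ _
  · intro p
    obtain ⟨n, W, hW, hn⟩ := h1 p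
    rw [mem_interior_iff_mem_nhds]
    have hcont : Continuous fun r : N × N => (it n (r.1, r.1, r.2, 1)).2 :=
      continuous_snd.comp ((hit n).continuous.comp (by fun_prop))
    have hlim : Tendsto (fun r : N × N => (it n (r.1, r.1, r.2, 1)).2) (𝓝 (p, p)) (𝓝 p) := by
      have := hcont.tendsto (p, p)
      simpa only [ityy] using this
    filter_upwards [hlim.eventually hW, (continuous_snd.tendsto (p, p)).eventually hW,
      (continuous_snd.tendsto (p, p)).eventually (hM p)] with r hr1 hr2 hr3
    -- Near the diagonal the earlier steps leave `y` inside `W`, so step `n` lands exactly on `z`;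
    -- later steps see zero displacement.
    have hstep : it (n + 1) (r.1, r.1, r.2, 1) = (r.2, r.2) := by
      rw [it_succ, itdiag, hn _ hr1 _ hr2]
    have hreach : ∀ m ≥ n + 1, it m (r.1, r.1, r.2, 1) = (r.2, r.2) := by
      intro m hm
      induction m, hm using Nat.le_induction with
      | base => exact hstep
      | succ m hm ih => rw [it_succ, ih, hyy]
    change M (r.1, r.1, r.2, 1) = r.2
    rw [hr3 (max (A p) (n + 1)) (le_max_left _ _), hreach _ (le_max_right _ _)]
  · intro x y z
    simp [M, it0]
  · intro x y t
    simp [M, ityy]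
  · intro y z h
    exact interior_subset (s := {p : N × N | M (p.1, p.1, p.2, 1) = p.2}) h

end ManifoldTranslation

/-! ### Compactness and cones -/

/-- A tube lemma for the D-topology: if `W ⊆ ℝᵐ × X` is open along all plots of `X`, and `X` is
compact, then the set of `u` with `{u} × X ⊆ W` is open. -/
theorem isOpen_setOf_forall_mem {X : Type u} [DiffeologicalSpace X]
    (hX : @CompactSpace X dTopology) {m : ℕ} {W : Set (EuclideanSpace ℝ (Fin m) × X)}
    (hW : ∀ (l : ℕ) (p : EuclideanSpace ℝ (Fin l) → X), IsPlot p →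
      IsOpen {q : EuclideanSpace ℝ (Fin m) × EuclideanSpace ℝ (Fin l) | (q.1, p q.2) ∈ W}) :
    IsOpen {u | ∀ x, (u, x) ∈ W} := by
  let : TopologicalSpace X := dTopology
  rw [isOpen_iff_mem_nhds]
  intro u₀ hu₀
  -- Closed balls are compact, which makes each `O k` open along plots, hence D-open. The `O k`
  -- increase, so compactness of X selects a single radius.
  let K : ℕ → Set (EuclideanSpace ℝ (Fin m)) := fun k => Metric.closedBall u₀ (1 / ((k : ℝ) + 1))
  let O : ℕ → Set X := fun k => {x | ∀ u ∈ K k, (u, x) ∈ W}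
  have hO : ∀ k, IsOpen (O k) := by
    intro k
    rw [isOpen_iff_preimages_plots]
    intro l p hp
    rw [isOpen_iff_mem_nhds]
    intro t ht
    refine IsCompact.eventually_forall_of_forall_eventually (isCompact_closedBall _ _)
      (P := fun t u => (u, p t) ∈ W) fun u hu => ?_
    have h1 : {q : EuclideanSpace ℝ (Fin m) × EuclideanSpace ℝ (Fin l) | (q.1, p q.2) ∈ W} ∈
      𝓝 (u, t) := (hW l p hp).mem_nhds (ht u hu)
    exact (continuous_swap.tendsto (t, u)).eventually h1
  have hmono : Monotone O := fun a b hab x hx u hu =>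
    hx u (Metric.closedBall_subset_closedBall (Nat.one_div_le_one_div hab) hu)
  have hcover : univ ⊆ ⋃ k, O k := by
    intro x _
    have h1 := hW 0 (fun _ => x) isPlot_const
    have h2 : {u : EuclideanSpace ℝ (Fin m) | (u, x) ∈ W} ∈ 𝓝 u₀ :=
      (h1.preimage (Continuous.prodMk_left (0 : EuclideanSpace ℝ (Fin 0)))).mem_nhds (hu₀ x)
    obtain ⟨ε, hε, hball⟩ := Metric.mem_nhds_iff.1 h2
    obtain ⟨k, hk⟩ := exists_nat_one_div_lt hε
    exact mem_iUnion.2 ⟨k, fun u hu => hball (Metric.closedBall_subset_ball hk hu)⟩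
  obtain ⟨k, hk⟩ := (isCompact_univ (X := X)).elim_directed_cover O hO hcover hmono.directed_le
  filter_upwards [Metric.closedBall_mem_nhds u₀ (Nat.one_div_pos_of_nat (n := k) (α := ℝ))]
    with u hu x
  exact hk (mem_univ x) u hu

/-- A closed cone is a smooth retract, fixing the cone pointwise, into any open neighbourhood. -/
theorem exists_contDiff_mapsTo_of_cone {m : ℕ} {L V : Set (EuclideanSpace ℝ (Fin m))}
    (hL : IsClosed L) (hcone : ∀ u ∈ L, ∀ t : ℝ, t • u ∈ L) (hV : IsOpen V) (h0 : 0 ∈ V)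
    (hLV : L ⊆ V) :
    ∃ φ : EuclideanSpace ℝ (Fin m) → EuclideanSpace ℝ (Fin m), ContDiff ℝ ∞ φ ∧
      (∀ u, φ u ∈ V) ∧ ∀ u ∈ L, φ u = u := by
  let V' : Set (EuclideanSpace ℝ (Fin m)) := {u | ∀ t ∈ Icc (0 : ℝ) 1, t • u ∈ V}
  have hV' : IsOpen V' := by
    rw [isOpen_iff_mem_nhds]
    intro u hu
    refine IsCompact.eventually_forall_of_forall_eventually isCompact_Icc
      (P := fun u (t : ℝ) => t • u ∈ V) fun t ht => ?_
    have hc : Continuous fun p : EuclideanSpace ℝ (Fin m) × ℝ => p.2 • p.1 := by fun_prop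
    exact (hc.tendsto (u, t)).eventually (hV.mem_nhds (hu t ht))
  obtain ⟨f, hf1, hf0, hf⟩ := exists_contMDiffMap_one_nhds_of_subset_interior
    (𝓘(ℝ, EuclideanSpace ℝ (Fin m))) (n := ⊤) (t := V') hL
    (by rw [hV'.interior_eq]; exact fun u hu t _ => hLV (hcone u hu t))
  refine ⟨fun u => f u • u, f.contMDiff.contDiff.smul contDiff_id, fun u => ?_, fun u hu => ?_⟩
  · by_cases hu : u ∈ V'
    · exact hu _ (hf u)
    · simpa [hf0 u hu] using h0
  · simp [hf1.self_of_nhdsSet u hu]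

/-- A map out of `ℝᵐ × X` is smooth if it is so locally in the first variable. -/
theorem dSmooth_of_locally_fst {X : Type u} {Y : Type v} [DiffeologicalSpace X]
    [DiffeologicalSpace Y] {m : ℕ} {F : EuclideanSpace ℝ (Fin m) × X → Y}
    (h : ∀ u, ∃ O : Set (EuclideanSpace ℝ (Fin m)), IsOpen O ∧ u ∈ O ∧
      ∃ G : EuclideanSpace ℝ (Fin m) × X → Y, DSmooth G ∧ ∀ v ∈ O, ∀ x, F (v, x) = G (v, x)) :
    DSmooth F := by
  intro k q hq
  have hq1 : ContDiff ℝ ∞ fun t => (q t).1 := hq.1.contDiff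
  refine DiffeologicalSpace.locality fun t => ?_
  obtain ⟨O, hO, hut, G, hG, hFG⟩ := h (q t).1
  refine ⟨_, hO.preimage hq1.continuous, hut, fun {l f} hf hfc => ?_⟩
  have : (F ∘ q) ∘ f = G ∘ (q ∘ f) := funext fun s => hFG _ (hf s) _
  rw [this]
  exact hG _ _ (isPlot_reparam hq hfc)

theorem DSmooth.prodMk {X Y Z : Type*} [DiffeologicalSpace X] [DiffeologicalSpace Y]
    [DiffeologicalSpace Z] {f : X → Y} {g : X → Z} (hf : DSmooth f) (hg : DSmooth g) :
    DSmooth fun x => (f x, g x) :=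
  fun n p hp => ⟨hf n p hp, hg n p hp⟩

theorem dSmooth_fst {X Y : Type*} [DiffeologicalSpace X] [DiffeologicalSpace Y] :
    DSmooth (Prod.fst : X × Y → X) := fun _ _ hp => hp.1

theorem dSmooth_snd {X Y : Type*} [DiffeologicalSpace X] [DiffeologicalSpace Y] :
    DSmooth (Prod.snd : X × Y → Y) := fun _ _ hp => hp.2

/-! ### Extension from a union of subspaces -/

/-- A globally defined smooth operation `M (x, y, z, t)` which moves `x` by `t` times the
displacement from `y` to `z`, as long as `y` and `z` are close. -/
structure SmoothTranslation (N : Type u) [TopologicalSpace N] [DiffeologicalSpace N] where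
  move : N × N × N × ℝ → N
  dSmooth_move : DSmooth move
  near : Set (N × N)
  isOpen_near : IsOpen near
  diag_mem_near : ∀ y, (y, y) ∈ near
  move_zero : ∀ x y z, move (x, y, z, 0) = x
  move_self : ∀ x y t, move (x, y, y, t) = x
  move_one : ∀ y z, (y, z) ∈ near → move (y, y, z, 1) = z

section Extension

variable {m : ℕ} {X : Type u} [DiffeologicalSpace X] {N : Type v} [TopologicalSpace N]
  [DiffeologicalSpace N]

/-- Compactness of `X` enters the extension argument only here: uniform closeness of two families is
an open condition on the parameter. -/
theorem isOpen_setOf_forall_near (hX : @CompactSpace X dTopology)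
    (hN : ∀ {n} (p : EuclideanSpace ℝ (Fin n) → N), IsPlot p → Continuous p)
    {D : Set (N × N)} (hD : IsOpen D) {a b : EuclideanSpace ℝ (Fin m) × X → N}
    (ha : DSmooth a) (hb : DSmooth b) : IsOpen {u | ∀ x, (a (u, x), b (u, x)) ∈ D} := by
  refine isOpen_setOf_forall_mem hX (W := {q | (a q, b q) ∈ D}) fun l p hp => ?_
  have key : ∀ c : EuclideanSpace ℝ (Fin m) × X → N, DSmooth c →
      Continuous fun q : EuclideanSpace ℝ (Fin m) × EuclideanSpace ℝ (Fin l) =>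
        c (q.1, p q.2) := by
    intro c hc
    let e := toEuclidean (E := EuclideanSpace ℝ (Fin m) × EuclideanSpace ℝ (Fin l))
    have h1 : ContDiff ℝ ∞ fun t => (e.symm t).1 := contDiff_fst.comp e.symm.contDiff
    have h2 : ContDiff ℝ ∞ fun t => (e.symm t).2 := contDiff_snd.comp e.symm.contDiff
    have h3 := hN _ (hc _ (fun t => ((e.symm t).1, p (e.symm t).2))
      ⟨h1.isPlot, isPlot_reparam hp h2⟩)
    have h4 := h3.comp e.continuous
    simpa [Function.comp_def] using h4
  exact hD.preimage ((key a ha).prodMk (key b hb))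

/-- One step of the extension: a map `w` and a map `g` that agree on the intersection of a closed
cone `L` with the fixed space of a projection `π` that preserves `L` can be merged into one which
agrees with `w` on `L` and with `g` on the fixed space. -/
theorem SmoothTranslation.exists_merge (τ : SmoothTranslation N)
    (hX : @CompactSpace X dTopology)
    (hN : ∀ {n} (p : EuclideanSpace ℝ (Fin n) → N), IsPlot p → Continuous p)
    {L : Set (EuclideanSpace ℝ (Fin m))} (hL : IsClosed L)
    (hcone : ∀ u ∈ L, ∀ t : ℝ, t • u ∈ L)
    (π : EuclideanSpace ℝ (Fin m) →L[ℝ] EuclideanSpace ℝ (Fin m))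
    (hπ : ∀ u, π (π u) = π u) (hπL : ∀ u ∈ L, π u ∈ L)
    {w g : EuclideanSpace ℝ (Fin m) × X → N} (hw : DSmooth w) (hg : DSmooth g)
    (hwg : ∀ u ∈ L, π u = u → ∀ x, w (u, x) = g (u, x)) :
    ∃ F : EuclideanSpace ℝ (Fin m) × X → N, DSmooth F ∧
      (∀ u ∈ L, ∀ x, F (u, x) = w (u, x)) ∧ (∀ u, π u = u → ∀ x, F (u, x) = g (u, x)) ∧
      ∀ x n₀, (∀ u, w (u, x) = n₀) → (∀ u, g (u, x) = n₀) → ∀ u, F (u, x) = n₀ := by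
  classical
  have hproj : DSmooth fun q : EuclideanSpace ℝ (Fin m) × X => (π q.1, q.2) :=
    (π.contDiff.dSmooth.comp dSmooth_fst).prodMk dSmooth_snd
  have hwπ : DSmooth fun q : EuclideanSpace ℝ (Fin m) × X => w (π q.1, q.2) := hw.comp hproj
  have hgπ : DSmooth fun q : EuclideanSpace ℝ (Fin m) × X => g (π q.1, q.2) := hg.comp hproj
  let Q : Set (EuclideanSpace ℝ (Fin m)) :=
    {u | ∀ x, (w (π u, x), g (π u, x)) ∈ τ.near}
  have hQ : IsOpen Q := isOpen_setOf_forall_near hX hN τ.isOpen_near hwπ hgπ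
  have hLQ : L ⊆ Q := by
    intro u hu x
    rw [hwg (π u) (hπL u hu) (hπ u)]
    exact τ.diag_mem_near _
  obtain ⟨β, hβ1, hβ0, -⟩ := exists_contMDiffMap_one_nhds_of_subset_interior
    (𝓘(ℝ, EuclideanSpace ℝ (Fin m))) (n := ⊤) (t := Q) hL (by rwa [hQ.interior_eq])
  have hβ : ContDiff ℝ ∞ β := β.contMDiff.contDiff
  let Q' : Set (EuclideanSpace ℝ (Fin m)) := interior {u | β u = 1}
  have hLQ' : L ⊆ Q' := subset_interior_iff_mem_nhdsSet.2 hβ1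
  have hQ'1 : ∀ u ∈ Q', β u = 1 := fun u hu =>
    interior_subset (s := {u : EuclideanSpace ℝ (Fin m) | β u = 1}) hu
  have hQ'Q : Q' ⊆ Q := fun u hu => by
    by_contra h
    have h1 := hQ'1 u hu
    rw [hβ0 u h] at h1
    exact zero_ne_one h1
  -- The manifold version of w(u) - w(πu) + g(πu).
  let F₁ : EuclideanSpace ℝ (Fin m) × X → N :=
    fun q => τ.move (w q, w (π q.1, q.2), g (π q.1, q.2), 1)
  have hF₁ : DSmooth F₁ := τ.dSmooth_move.comp
    (hw.prodMk (hwπ.prodMk (hgπ.prodMk dSmooth_const)))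
  -- Interpolates from `g ∘ π` at `β = 0` to `F₁` at `β = 1`; the latter endpoint is reached only
  -- where `F₁` is near `g ∘ π`, that is, on `C`.
  let F₂ : EuclideanSpace ℝ (Fin m) × X → N :=
    fun q => τ.move (g (π q.1, q.2), g (π q.1, q.2), F₁ q, β (π q.1))
  have hF₂ : DSmooth F₂ := τ.dSmooth_move.comp
    (hgπ.prodMk (hgπ.prodMk (hF₁.prodMk ((hβ.comp π.contDiff).dSmooth.comp dSmooth_fst))))
  let F : EuclideanSpace ℝ (Fin m) × X → N := fun q => if π q.1 ∈ Q' then F₁ q else F₂ q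
  let C : Set (EuclideanSpace ℝ (Fin m)) :=
    {u | ∀ x, (g (π u, x), F₁ (u, x)) ∈ τ.near}
  have hC : IsOpen C := isOpen_setOf_forall_near hX hN τ.isOpen_near hgπ hF₁
  have hB : IsOpen {u | β (π u) ≠ 1} :=
    isOpen_ne.preimage (hβ.continuous.comp π.continuous)
  have hF_on_Q' : ∀ u, π u ∈ Q' → ∀ x, F (u, x) = F₁ (u, x) := fun u hu x => if_pos hu
  have hF_off : ∀ u, β (π u) ≠ 1 → ∀ x, F (u, x) = F₂ (u, x) := fun u hu x =>
    if_neg fun h => hu (hQ'1 _ h)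
  have hF_C : ∀ u ∈ C, ∀ x, F (u, x) = F₂ (u, x) := by
    intro u hu x
    by_cases h : π u ∈ Q'
    · rw [hF_on_Q' u h]
      simp only [F₂, hQ'1 _ h]
      exact (τ.move_one _ _ (hu x)).symm
    · exact if_neg h
  have hFL : ∀ u ∈ L, ∀ x, F (u, x) = w (u, x) := by
    intro u hu x
    rw [hF_on_Q' u (hLQ' (hπL u hu))]
    simp only [F₁, hwg (π u) (hπL u hu) (hπ u), τ.move_self]
  have hF₁fix : ∀ u ∈ Q, π u = u → ∀ x, F₁ (u, x) = g (u, x) := by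
    intro u hu hπu x
    have h := hu x
    simp only [F₁, hπu] at h ⊢
    exact τ.move_one _ _ h
  have hFπ : ∀ u, π u = u → ∀ x, F (u, x) = g (u, x) := by
    intro u hu x
    by_cases h : u ∈ Q
    · by_cases h' : π u ∈ Q'
      · rw [hF_on_Q' u h', hF₁fix u h hu]
      · rw [show F (u, x) = F₂ (u, x) from if_neg h']
        simp only [F₂, hF₁fix u h hu, hu, τ.move_self]
    · rw [hF_off u (by rw [hu, hβ0 u h]; exact zero_ne_one)]
      simp only [F₂, hu, hβ0 u h, τ.move_zero]
  let H : Set (EuclideanSpace ℝ (Fin m)) := {u | π u = u}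
  have hH : IsClosed H := isClosed_eq π.continuous continuous_id
  -- On each of these three open sets `F` is a single smooth formula: `F₁` on the first, `F₂` on the
  -- other two.
  let V : Set (EuclideanSpace ℝ (Fin m)) := π ⁻¹' Q' ∪ ({u | β (π u) ≠ 1} ∪ C)
  have hV : IsOpen V := (isOpen_interior.preimage π.continuous).union (hB.union hC)
  have hHV : H ⊆ V := by
    intro u (hu : π u = u)
    by_cases h : u ∈ Q
    · refine .inr (.inr fun x => ?_)
      rw [hF₁fix u h hu, hu]
      exact τ.diag_mem_near _
    · exact .inr (.inl (by
        change β (π u) ≠ 1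
        rw [hu, hβ0 u h]; exact zero_ne_one))
  obtain ⟨φ, hφ, hφV, hφL⟩ := exists_contDiff_mapsTo_of_cone (L := L ∪ H) (V := V) (hL.union hH)
    (by
      rintro u (hu | hu) t
      · exact .inl (hcone u hu t)
      · exact .inr (by change π (t • u) = t • u; rw [map_smul, show π u = u from hu]))
    hV (hHV (show π 0 = 0 from map_zero π))
    (union_subset (fun u hu => .inl (hLQ' (hπL u hu))) hHV)
  have hφX : DSmooth fun q : EuclideanSpace ℝ (Fin m) × X => (φ q.1, q.2) :=
    (hφ.dSmooth.comp dSmooth_fst).prodMk dSmooth_snd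
  refine ⟨fun q => F (φ q.1, q.2), ?_, fun u hu x => ?_, fun u hu x => ?_, ?_⟩
  · refine dSmooth_of_locally_fst fun u => ?_
    rcases hφV u with hu | hu | hu
    · exact ⟨_, isOpen_interior.preimage (π.continuous.comp hφ.continuous), hu, _,
        hF₁.comp hφX, fun v hv x => hF_on_Q' _ hv x⟩
    · exact ⟨_, hB.preimage hφ.continuous, hu, _, hF₂.comp hφX, fun v hv x => hF_off _ hv x⟩
    · exact ⟨_, hC.preimage hφ.continuous, hu, _, hF₂.comp hφX, fun v hv x => hF_C _ hv x⟩
  · simp only [hφL u (.inl hu), hFL u hu]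
  · simp only [hφL u (.inr hu), hFπ u hu]
  · intro x n₀ h1 h2 u
    have hF₁x : ∀ u, F₁ (u, x) = n₀ := fun u => by simp only [F₁, h1, h2, τ.move_self]
    have hF₂x : ∀ u, F₂ (u, x) = n₀ := fun u => by simp only [F₂, hF₁x, h2, τ.move_self]
    simp only [F, hF₁x, hF₂x, ite_self]

/-- Maps given on the fixed spaces of finitely many commuting projections of `ℝᵐ`, and agreeing
on the intersections, extend to all of `ℝᵐ`. -/
theorem SmoothTranslation.exists_extension (τ : SmoothTranslation N)
    (hX : @CompactSpace X dTopology)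
    (hN : ∀ {n} (p : EuclideanSpace ℝ (Fin n) → N), IsPlot p → Continuous p)
    {J : Type*} [Finite J] [Nonempty J]
    (π : J → EuclideanSpace ℝ (Fin m) →L[ℝ] EuclideanSpace ℝ (Fin m))
    (hπ : ∀ j u, π j (π j u) = π j u) (hcomm : ∀ j k u, π j (π k u) = π k (π j u))
    {f : J → EuclideanSpace ℝ (Fin m) × X → N} (hf : ∀ j, DSmooth (f j))
    (hcompat : ∀ j k u, π j u = u → π k u = u → ∀ x, f j (u, x) = f k (u, x)) :
    ∃ F : EuclideanSpace ℝ (Fin m) × X → N, DSmooth F ∧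
      (∀ j u, π j u = u → ∀ x, F (u, x) = f j (u, x)) ∧
      ∀ x n₀, (∀ j u, f j (u, x) = n₀) → ∀ u, F (u, x) = n₀ := by
  classical
  have := Fintype.ofFinite J
  have j₀ : J := Classical.arbitrary J
  suffices h : ∀ s : Finset J, ∃ F : EuclideanSpace ℝ (Fin m) × X → N, DSmooth F ∧
      (∀ j ∈ s, ∀ u, π j u = u → ∀ x, F (u, x) = f j (u, x)) ∧
      ∀ x n₀, (∀ j u, f j (u, x) = n₀) → ∀ u, F (u, x) = n₀ by
    simpa using h Finset.univ
  intro s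
  induction s using Finset.induction_on with
  | empty => exact ⟨f j₀, hf j₀, by simp, fun x n₀ h => h j₀⟩
  | insert k s _ ih =>
    obtain ⟨w, hw, hws, hwx⟩ := ih
    obtain ⟨F, hF, hFL, hFk, hFx⟩ := τ.exists_merge hX hN (L := ⋃ j ∈ s, {u | π j u = u})
      (s.finite_toSet.isClosed_biUnion fun j _ => isClosed_eq (π j).continuous continuous_id)
      (by
        simp only [mem_iUnion, exists_prop]
        rintro u ⟨j, hj, hu⟩ t
        exact ⟨j, hj, by change π j (t • u) = t • u; rw [map_smul, show π j u = u from hu]⟩)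
      (π k) (hπ k)
      (by
        simp only [mem_iUnion, exists_prop]
        rintro u ⟨j, hj, hu⟩
        exact ⟨j, hj, by
          change π j (π k u) = π k u
          rw [hcomm, show π j u = u from hu]⟩)
      hw (hf k)
      (by
        simp only [mem_iUnion, exists_prop]
        rintro u ⟨j, hj, hu⟩ hku x
        rw [hws j hj u hu, hcompat j k u hu hku])
    refine ⟨F, hF, ?_, fun x n₀ h => hFx x n₀ (hwx x n₀ h) (h k)⟩
    intro j hj u hu x
    rcases Finset.mem_insert.1 hj with rfl | hj
    · exact hFk u hu x
    · rw [hFL u (mem_biUnion hj hu), hws j hj u hu]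

end Extension

/-! ### Horns and affine simplices -/

section Kan

open CategoryTheory Opposite Simplicial

/-- A criterion for fibrancy: the smooth singular set is a Kan complex if every family of simplices
that agree on common faces is the family of faces of a simplex. -/
theorem fibrant_of_exists_filler {Y : Type u} [DiffeologicalSpace Y]
    (h : ∀ (n : ℕ) (i : Fin (n + 2)) (σ : ∀ j, j ≠ i → SmoothMap (AffineSimplex n) Y),
      (∀ (j k : Fin (n + 2)) (hj : j ≠ i) (hk : k ≠ i) (m : ℕ)
        (a b : Fin (m + 1) →o Fin (n + 1)), (∀ p, j.succAbove (a p) = k.succAbove (b p)) →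
        ∀ v, σ j hj (AffineSimplex.map a v) = σ k hk (AffineSimplex.map b v)) →
      ∃ τ : SmoothMap (AffineSimplex (n + 1)) Y,
        ∀ j hj v, τ (AffineSimplex.map j.succAbove v) = σ j hj v) :
    Fibrant Y := by
  refine SSet.KanComplex.iff.2 fun n i f hf => ?_
  have hface : ∀ (j k : Fin (n + 2)) (hj : j ≠ i) (hk : k ≠ i) (m : ℕ)
      (a b : ⦋m⦌ ⟶ ⦋n⦌), a ≫ SimplexCategory.δ j = b ≫ SimplexCategory.δ k →
      SSet.stdSimplex.map a ≫ f j hj = SSet.stdSimplex.map b ≫ f k hk := by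
    intro j k hj hk m a b hab
    rw [← hf.ι_desc j hj, ← hf.ι_desc k hk, ← Category.assoc, ← Category.assoc]
    congr 1
    -- The two maps into the horn may be compared after inclusion into the full simplex, where they
    -- come from equal vertex maps.
    rw [← cancel_mono (SSet.Subcomplex.ι _), Category.assoc, Category.assoc, SSet.horn.ι_ι,
      SSet.horn.ι_ι]
    exact (SSet.stdSimplex.{u}.map_comp a (SimplexCategory.δ j)).symm.trans
      ((congrArg SSet.stdSimplex.{u}.map hab).trans
        (SSet.stdSimplex.{u}.map_comp b (SimplexCategory.δ k)))
  obtain ⟨τ, hτ⟩ := h n i (fun j hj => SSet.yonedaEquiv (f j hj)) (by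
    intro j k hj hk m a b hab v
    have h1 := hface j k hj hk m (SimplexCategory.Hom.mk a) (SimplexCategory.Hom.mk b) (by
      ext p : 3
      exact hab p)
    have h2 := congrArg SSet.yonedaEquiv h1
    rw [← SSet.yonedaEquiv_naturality, ← SSet.yonedaEquiv_naturality] at h2
    exact congrArg (fun s : SmoothMap (AffineSimplex m) Y => s v) h2)
  refine ⟨SSet.yonedaEquiv.symm (show (smoothSingular Y).obj (op ⦋n + 1⦌) from τ), fun j hj => ?_⟩
  apply SSet.yonedaEquiv.injective
  refine (SSet.yonedaEquiv_naturality (SimplexCategory.δ j) _).symm.trans ?_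
  rw [Equiv.apply_symm_apply]
  exact SmoothMap.ext (funext fun v => hτ j hj v)

end Kan

/-- Every nonempty subset of a finite linear order is a monotone retract. -/
theorem exists_orderHom_retraction {n : ℕ} (C : Finset (Fin n)) (hC : C.Nonempty) :
    ∃ e : Fin n →o Fin n, (∀ p, e p ∈ C) ∧ ∀ p ∈ C, e p = p := by
  classical
  -- Round down to the largest element of `C` below `p`, or to the minimum of `C` if there is none.
  let e : Fin n → Fin n := fun p =>
    if h : (C.filter (· ≤ p)).Nonempty then (C.filter (· ≤ p)).max' h else C.min' hC
  have hmem : ∀ p, e p ∈ C := by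
    intro p
    by_cases h : (C.filter (· ≤ p)).Nonempty
    · simp only [e, dif_pos h]
      exact (Finset.mem_filter.1 (Finset.max'_mem _ h)).1
    · simp only [e, dif_neg h]
      exact Finset.min'_mem _ _
  refine ⟨⟨e, fun p q hpq => ?_⟩, hmem, fun p hp => ?_⟩
  · by_cases h : (C.filter (· ≤ p)).Nonempty
    · have h' : (C.filter (· ≤ q)).Nonempty :=
        h.mono fun r hr => by
          rw [Finset.mem_filter] at hr ⊢
          exact ⟨hr.1, hr.2.trans hpq⟩
      simp only [e, dif_pos h, dif_pos h']
      refine Finset.le_max' _ _ ?_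
      have := Finset.mem_filter.1 (Finset.max'_mem _ h)
      exact Finset.mem_filter.2 ⟨this.1, this.2.trans hpq⟩
    · simp only [e, dif_neg h]
      exact Finset.min'_le _ _ (hmem q)
  · have h : (C.filter (· ≤ p)).Nonempty := ⟨p, by simp [hp]⟩
    change e p = p
    simp only [e, dif_pos h]
    exact le_antisymm (Finset.mem_filter.1 (Finset.max'_mem _ h)).2
      (Finset.le_max' _ _ (by simp [hp]))

namespace AffineSimplex

/-- The affine retraction of `ℝⁿ⁺¹` onto `𝔸ⁿ` in the direction of the `i`-th coordinate. -/
noncomputable def retraction {n : ℕ} (i : Fin (n + 1)) (x : EuclideanSpace ℝ (Fin (n + 1))) :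
    AffineSimplex n :=
  ⟨x + EuclideanSpace.single i (1 - ∑ k, x k), by simp [Finset.sum_add_distrib]⟩

theorem retraction_coe {n : ℕ} (i : Fin (n + 1)) (x : AffineSimplex n) :
    retraction i (x : EuclideanSpace ℝ (Fin (n + 1))) = x := by
  ext k
  simp [retraction, x.2]

theorem retraction_apply_of_ne {n : ℕ} {i j : Fin (n + 1)} (hj : j ≠ i)
    (x : EuclideanSpace ℝ (Fin (n + 1))) : (retraction i x).1 j = x j := by
  simp [retraction, hj]

theorem dSmooth_retraction {n : ℕ} (i : Fin (n + 1)) : DSmooth (retraction i) := by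
  intro k p hp
  have hp' : ContDiff ℝ ∞ p := hp.contDiff
  have h : ContDiff ℝ ∞ fun t => (retraction i (p t) : EuclideanSpace ℝ (Fin (n + 1))) := by
    rw [contDiff_euclidean] at hp' ⊢
    intro j
    simp only [retraction, PiLp.add_apply, PiLp.single_apply]
    refine (hp' j).add ?_
    split_ifs
    · exact contDiff_const.sub (ContDiff.sum fun l _ => hp' l)
    · exact contDiff_const
  exact h.isPlot

/-- The linear projection of `ℝⁿ⁺¹` onto the hyperplane `xⱼ = 0` which adds `xⱼ` to `xᵢ`. -/
noncomputable def collapse {n : ℕ} (i j : Fin (n + 1)) :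
    EuclideanSpace ℝ (Fin (n + 1)) →L[ℝ] EuclideanSpace ℝ (Fin (n + 1)) :=
  ContinuousLinearMap.id ℝ _ + (EuclideanSpace.proj j).smulRight
    (EuclideanSpace.single i (1 : ℝ) - EuclideanSpace.single j (1 : ℝ))

theorem collapse_apply {n : ℕ} (i j : Fin (n + 1)) (x : EuclideanSpace ℝ (Fin (n + 1))) :
    collapse i j x = x + x j • (EuclideanSpace.single i (1 : ℝ) - EuclideanSpace.single j 1) := by
  simp [collapse]

theorem collapse_apply_self {n : ℕ} {i j : Fin (n + 1)} (hj : j ≠ i)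
    (x : EuclideanSpace ℝ (Fin (n + 1))) : collapse i j x j = 0 := by
  simp [collapse_apply, hj]

theorem collapse_apply_of_ne {n : ℕ} {i j k : Fin (n + 1)} (hk : k ≠ i) (hkj : k ≠ j)
    (x : EuclideanSpace ℝ (Fin (n + 1))) : collapse i j x k = x k := by
  simp [collapse_apply, hk, hkj]

theorem collapse_eq_self_iff {n : ℕ} {i j : Fin (n + 1)} (hj : j ≠ i)
    (x : EuclideanSpace ℝ (Fin (n + 1))) : collapse i j x = x ↔ x j = 0 := by
  refine ⟨fun h => ?_, fun h => by simp [collapse_apply, h]⟩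
  rw [← h, collapse_apply_self hj]

theorem collapse_collapse {n : ℕ} {i j : Fin (n + 1)} (hj : j ≠ i)
    (x : EuclideanSpace ℝ (Fin (n + 1))) : collapse i j (collapse i j x) = collapse i j x :=
  (collapse_eq_self_iff hj _).2 (collapse_apply_self hj x)

theorem collapse_comm {n : ℕ} {i j k : Fin (n + 1)} (hj : j ≠ i) (hk : k ≠ i)
    (x : EuclideanSpace ℝ (Fin (n + 1))) :
    collapse i j (collapse i k x) = collapse i k (collapse i j x) := by
  rcases eq_or_ne j k with rfl | hjk
  · rfl
  rw [collapse_apply i j (collapse i k x), collapse_apply i k (collapse i j x),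
    collapse_apply_of_ne hj hjk, collapse_apply_of_ne hk hjk.symm, collapse_apply, collapse_apply]
  abel

/-- A map of vertices that is the identity on the support of `x` fixes `x`. -/
theorem map_eq_self {n : ℕ} {e : Fin (n + 1) → Fin (n + 1)} {x : AffineSimplex n}
    (h : ∀ p, x.1 p ≠ 0 → e p = p) : map e x = x := by
  ext k
  simp only [map, Finset.sum_filter]
  rw [Finset.sum_eq_single k]
  · by_cases hk : x.1 k = 0
    · simp [hk]
    · simp [h k hk]
  · intro p _ hpk
    by_cases hp : x.1 p = 0
    · simp [hp]
    · rw [h p hp, if_neg hpk]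
  · simp

end AffineSimplex

/-- A left inverse of the `j`-th face inclusion of vertices. -/
theorem exists_leftInverse_succAbove {n : ℕ} (j : Fin (n + 2)) :
    ∃ s : Fin (n + 2) → Fin (n + 1), (∀ p, s (j.succAbove p) = p) ∧
      ∀ p, p ≠ j → j.succAbove (s p) = p := by
  have hinv := Function.leftInverse_invFun (Fin.succAbove_right_injective (p := j))
  refine ⟨Function.invFun j.succAbove, hinv, fun p hp => ?_⟩
  obtain ⟨q, rfl⟩ := Fin.exists_succAbove_eq hp
  rw [hinv q]

/-! ### Filling horns -/

section Filler

variable {X : Type u} [DiffeologicalSpace X] {N : Type v} [TopologicalSpace N]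
  [DiffeologicalSpace N]

/-- A compatible family of faces of a simplex in `C^∞(X, N)` has a filler, which moreover is
constant at each point of `X` at which all the faces are constant. -/
theorem SmoothTranslation.exists_filler (τ : SmoothTranslation N)
    (hX : @CompactSpace X dTopology)
    (hN : ∀ {n} (p : EuclideanSpace ℝ (Fin n) → N), IsPlot p → Continuous p)
    {n : ℕ} {i : Fin (n + 2)} (σ : ∀ j, j ≠ i → SmoothMap (AffineSimplex n) (SmoothMap X N))
    (hσ : ∀ (j k : Fin (n + 2)) (hj : j ≠ i) (hk : k ≠ i) (m : ℕ)
      (a b : Fin (m + 1) →o Fin (n + 1)), (∀ p, j.succAbove (a p) = k.succAbove (b p)) →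
      ∀ v, σ j hj (AffineSimplex.map a v) = σ k hk (AffineSimplex.map b v)) :
    ∃ ρ : SmoothMap (AffineSimplex (n + 1)) (SmoothMap X N),
      (∀ j hj v, ρ (AffineSimplex.map j.succAbove v) = σ j hj v) ∧
      ∀ x n₀, (∀ j hj v, σ j hj v x = n₀) → ∀ v, ρ v x = n₀ := by
  classical
  choose s hs hs' using fun j : Fin (n + 2) => exists_leftInverse_succAbove j
  have : Nonempty {j // j ≠ i} := nonempty_subtype.2 (exists_ne i)
  -- Any smooth extension of the face map off its hyperplane serves here. Retracting in direction
  -- `i` leaves the other coordinates, hence the hyperplanes u_j = 0, untouched.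
  let f : {j // j ≠ i} → EuclideanSpace ℝ (Fin (n + 2)) × X → N := fun j q =>
    σ j.1 j.2 (AffineSimplex.map (s j.1) (AffineSimplex.retraction i q.1)) q.2
  have hf : ∀ j, DSmooth (f j) := by
    intro j k q hq
    have h1 : IsPlot fun t => σ j.1 j.2
        (AffineSimplex.map (s j.1) (AffineSimplex.retraction i (q t).1)) :=
      (((σ j.1 j.2).smooth.comp (AffineSimplex.dSmooth_map (s j.1))).comp
        (AffineSimplex.dSmooth_retraction i)) k _ hq.1
    exact h1 k (fun t => (t, (q t).2)) ⟨isPlot_id, hq.2⟩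
  have hface : ∀ (j k : Fin (n + 2)) (hj : j ≠ i) (hk : k ≠ i) (v : AffineSimplex (n + 1)),
      v.1 j = 0 → v.1 k = 0 →
      σ j hj (AffineSimplex.map (s j) v) = σ k hk (AffineSimplex.map (s k) v) := by
    intro j k hj hk v hvj hvk
    -- `s j` need not be monotone at its arbitrary value on `j`. Composing with a monotone
    -- retraction onto the vertices other than `j` and `k` makes it simplicial without changing `v`.
    obtain ⟨e, he, he'⟩ := exists_orderHom_retraction (Finset.univ \ {j, k})
      ⟨i, by simp [hj.symm, hk.symm]⟩
    have hej : ∀ p, e p ≠ j ∧ e p ≠ k := fun p => by simpa using he p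
    have hmono : ∀ l, (∀ p, e p ≠ l) → Monotone (s l ∘ e) := fun l hl p q hpq => by
      rw [← (Fin.strictMono_succAbove l).le_iff_le]
      simp only [Function.comp_apply, hs' l _ (hl p), hs' l _ (hl q)]
      exact e.monotone hpq
    have hev : AffineSimplex.map e v = v := AffineSimplex.map_eq_self fun p hp => he' p (by
      simp only [Finset.mem_sdiff, Finset.mem_univ, Finset.mem_insert, Finset.mem_singleton,
        true_and, not_or]
      exact ⟨fun h => hp (h ▸ hvj), fun h => hp (h ▸ hvk)⟩)
    have h := hσ j k hj hk (n + 1) ⟨s j ∘ e, hmono j fun p => (hej p).1⟩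
      ⟨s k ∘ e, hmono k fun p => (hej p).2⟩
      (fun p => (hs' j _ (hej p).1).trans (hs' k _ (hej p).2).symm) v
    change σ j hj (AffineSimplex.map (s j ∘ e) v) = σ k hk (AffineSimplex.map (s k ∘ e) v) at h
    rwa [← AffineSimplex.map_map, ← AffineSimplex.map_map, hev] at h
  obtain ⟨F, hF, hFf, hFx⟩ := τ.exists_extension hX hN
    (fun j : {j // j ≠ i} => AffineSimplex.collapse i j.1)
    (fun j => AffineSimplex.collapse_collapse j.2)
    (fun j k => AffineSimplex.collapse_comm j.2 k.2) hf
    (fun j k u hj hk x => by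
      rw [AffineSimplex.collapse_eq_self_iff j.2] at hj
      rw [AffineSimplex.collapse_eq_self_iff k.2] at hk
      exact congrArg (fun g : SmoothMap X N => g x) (hface j.1 k.1 j.2 k.2 _
        ((AffineSimplex.retraction_apply_of_ne j.2 u).trans hj)
        ((AffineSimplex.retraction_apply_of_ne k.2 u).trans hk)))
  refine ⟨⟨fun v => ⟨fun x => F (v.1, x), fun k q hq => hF k _ ⟨isPlot_const, hq⟩⟩,
    fun k p hp l q hq => hF l _ ⟨isPlot_reparam (X := EuclideanSpace ℝ (Fin (n + 2)))
      (p := fun t => (p t).1) hp hq.1.contDiff, hq.2⟩⟩, ?_, ?_⟩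
  · intro j hj v
    refine SmoothMap.ext (funext fun x => ?_)
    have hv : (AffineSimplex.map j.succAbove v).1 j = 0 := by
      simp [AffineSimplex.map, Fin.succAbove_ne]
    refine (hFf ⟨j, hj⟩ _ ((AffineSimplex.collapse_eq_self_iff hj _).2 hv) x).trans ?_
    simp only [f, AffineSimplex.retraction_coe, AffineSimplex.map_map]
    rw [show s j ∘ j.succAbove = id from funext (hs j), AffineSimplex.map_id]
    rfl
  · intro x n₀ h v
    exact hFx x n₀ (fun j u => h j.1 j.2 _) v.1

theorem SmoothTranslation.fibrant_smoothMap (τ : SmoothTranslation N)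
    (hX : @CompactSpace X dTopology)
    (hN : ∀ {n} (p : EuclideanSpace ℝ (Fin n) → N), IsPlot p → Continuous p) :
    Fibrant (SmoothMap X N) :=
  fibrant_of_exists_filler fun _ _ σ hσ =>
    let ⟨ρ, hρ, _⟩ := τ.exists_filler hX hN σ hσ
    ⟨ρ, hρ⟩

theorem SmoothTranslation.fibrant_pointedSmoothMap (τ : SmoothTranslation N)
    (hX : @CompactSpace X dTopology)
    (hN : ∀ {n} (p : EuclideanSpace ℝ (Fin n) → N), IsPlot p → Continuous p) (x₀ : X) (n₀ : N) :
    Fibrant (PointedSmoothMap X N x₀ n₀) := by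
  refine fibrant_of_exists_filler fun n i σ hσ => ?_
  obtain ⟨ρ, hρ, hρx⟩ := τ.exists_filler hX hN
    (fun j hj => ⟨fun v => (σ j hj v).1, (σ j hj).smooth⟩)
    (fun j k hj hk m a b hab v => congrArg Subtype.val (hσ j k hj hk m a b hab v))
  exact ⟨⟨fun v => ⟨ρ v, hρx x₀ n₀ (fun j hj v => (σ j hj v).2) v⟩, ρ.smooth⟩,
    fun j hj v => Subtype.ext (hρ j hj v)⟩

end Filler

/-! ### Manifolds and the circle -/

section Manifold

/-- The operation of a `SmoothTranslation` on a smooth manifold. -/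
theorem nonempty_smoothTranslation (d : ℕ) (N : Type u) [TopologicalSpace N]
    [ChartedSpace (EuclideanSpace ℝ (Fin d)) N] [IsManifold (𝓡 d) ∞ N] [T2Space N]
    [SecondCountableTopology N] :
    letI : DiffeologicalSpace N := standardDiffeology d N
    Nonempty (SmoothTranslation N) := by
  let : DiffeologicalSpace N := standardDiffeology d N
  obtain ⟨M, D, hM, hD, hdiag, h0, hself, h1⟩ := exists_translation d N
  exact ⟨⟨M, fun n p hp => hM.comp (ContMDiff.prodMk hp.1 (ContMDiff.prodMk hp.2.1
    (ContMDiff.prodMk hp.2.2.1 hp.2.2.2.contDiff.contMDiff))), D, hD, hdiag, h0, hself, h1⟩⟩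

/-- The exponential plot is continuous for the D-topology and maps the closed interval [-π, π] onto
the circle. -/
theorem compactSpace_dTopology_circle :
    @CompactSpace Circle (@dTopology Circle (standardDiffeology 1 Circle)) := by
  let : DiffeologicalSpace Circle := standardDiffeology 1 Circle
  let p : EuclideanSpace ℝ (Fin 1) → Circle := fun t => Circle.exp (t 0)
  have hp : IsPlot p := by
    have h : ContDiff ℝ ∞ fun t : EuclideanSpace ℝ (Fin 1) => t 0 :=
      contDiff_euclidean.1 contDiff_id 0
    exact contMDiff_circleExp.comp h.contMDiff
  have hcont := hp.continuous
  have hK := (isCompact_closedBall (0 : EuclideanSpace ℝ (Fin 1)) Real.pi)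
  refine @CompactSpace.mk Circle dTopology ?_
  have himage := @IsCompact.image _ _ _ dTopology _ p hK hcont
  convert himage
  refine (Set.eq_univ_of_forall fun z => ?_).symm
  refine ⟨EuclideanSpace.single 0 (Complex.arg z), ?_, ?_⟩
  · simpa using Complex.abs_arg_le_pi z
  · simp [p, Circle.exp_arg]

end Manifold

end Diffeology

open Diffeology in
theorem mainTheorem9 (d : ℕ) (N : Type*) [TopologicalSpace N]
    [ChartedSpace (EuclideanSpace ℝ (Fin d)) N] [IsManifold (𝓡 d) ∞ N]
    [T2Space N] [SecondCountableTopology N] :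
    letI : DiffeologicalSpace N := standardDiffeology d N
    letI : DiffeologicalSpace Circle := standardDiffeology 1 Circle
    (∀ (X : Type*) [DiffeologicalSpace X], @CompactSpace X dTopology →
      Fibrant (SmoothMap X N) ∧
      ∀ (x₀ : X) (n₀ : N), Fibrant (PointedSmoothMap X N x₀ n₀)) ∧
    Fibrant (SmoothMap Circle N) ∧
    ∀ (s₀ : Circle) (n₀ : N), Fibrant (PointedSmoothMap Circle N s₀ n₀) := by
  let : DiffeologicalSpace N := standardDiffeology d N
  let : DiffeologicalSpace Circle := standardDiffeology 1 Circle
  obtain ⟨τ⟩ := nonempty_smoothTranslation d N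
  have hN : ∀ {n} (p : EuclideanSpace ℝ (Fin n) → N), IsPlot p → Continuous p :=
    fun p hp => ContMDiff.continuous (I := 𝓡 _) (I' := 𝓡 d) (n := ∞) hp
  exact ⟨fun X _ hX => ⟨τ.fibrant_smoothMap hX hN, τ.fibrant_pointedSmoothMap hX hN⟩,
    τ.fibrant_smoothMap compactSpace_dTopology_circle hN,
    τ.fibrant_pointedSmoothMap compactSpace_dTopology_circle hN⟩
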